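/- Let $G=(V,E)$ be a finite connected simple undirected graph with at least one edge. Let $\mathbf u$ be the uniform distribution on the set of spanning trees of $G$, for $e\in E$ let $u_e=\mathbb P_{T\sim\mathbf u}(e\in T)$ be the probability that $e$ belongs to a uniformly random spanning tree, and let $\kappa(G,\mathbf u)=\min_{e\in E}u_e$. (The number $u_e$ is also known as the effective resistance of $e$.) 1. If $G$ has maximum degree $d$, then $$\kappa(G,\mathbf u)\ \ge\ \frac{2}{d+1}.$$ 2. If $g>3$ is an integer and $G$ has girth at least $g$ (that is, every cycle of $G$ has length at least $g$; a graph without cycles has infinite girth), then $$\kappa(G,\mathbf u)\ \ge\ \frac{1}{1+|E|/(g-1)^2}.$$ -/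

import Mathlib

namespace SpanTree

variable {V : Type*}

/-- The spanning trees of `G`: subgraphs of `G` on the whole vertex set that are trees. -/
def SpanningTree (G : SimpleGraph V) : Type _ :=
  {T : SimpleGraph V // T ≤ G ∧ T.IsTree}

noncomputable instance SpanningTree.instFintype [Finite V] (G : SimpleGraph V) :
    Fintype (SpanningTree G) :=
  have : Finite (SpanningTree G) :=
    inferInstanceAs (Finite {T : SimpleGraph V // T ≤ G ∧ T.IsTree})
  Fintype.ofFinite _

theorem SpanningTree.nonempty {G : SimpleGraph V} [Finite V] (hG : G.Connected) :
    Nonempty (SpanningTree G) := by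
  obtain ⟨T, hT, hT'⟩ := hG.exists_isTree_le
  exact ⟨⟨T, hT, hT'⟩⟩

/-- Probability distributions on the spanning trees of `G`: families `(ρ T)` of nonnegative
reals with `∑ T, ρ T = 1`. -/
def TreeDistribution [Finite V] (G : SimpleGraph V) : Type _ :=
  stdSimplex ℝ (SpanningTree G)

/-- The uniform distribution on the spanning trees of a connected finite graph. -/
noncomputable def uniform [Finite V] (G : SimpleGraph V) (hG : G.Connected) :
    TreeDistribution G :=
  ⟨fun _ => 1 / (Fintype.card (SpanningTree G) : ℝ), by
    have := SpanningTree.nonempty hG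
    refine ⟨fun _ => by positivity, ?_⟩
    simp⟩

open Classical in
/-- The probability that the edge `e` belongs to a random spanning tree with law `ρ`. -/
noncomputable def edgeProb [Finite V] {G : SimpleGraph V} (ρ : TreeDistribution G)
    (e : Sym2 V) : ℝ :=
  ∑ T : SpanningTree G, ρ.1 T * (if e ∈ T.1.edgeSet then 1 else 0)

/-- The minimum, over the edges `e` of `G`, of the probability of `e` under `ρ`. -/
noncomputable def kappa [Finite V] {G : SimpleGraph V} [Fintype G.edgeSet]
    (hE : G.edgeFinset.Nonempty) (ρ : TreeDistribution G) : ℝ :=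
  G.edgeFinset.inf' hE (edgeProb ρ)

end SpanTree

/-!
Fix an edge `xy` of `G`, and let `N` be the number of spanning trees and `M` the number of those
containing `xy`. The heart of the proof is one half of Dirichlet's principle for the effective
resistance `M / N`: for every `f : V → ℝ`,
`(f x - f y)² N ≤ E(f) M`, where `E(f) = ∑_{uv ∈ E} (f u - f v)²`
(`sq_sub_mul_card_trees_le`). It is obtained without determinants or linear systems, as follows.

Call a spanning forest with exactly two components, one containing `x` and the other `y`,
*separating*. Adding an edge `uv` that leaves the `x`-side of a separating forest gives a spanning
tree whose path from `x` to `y` traverses `u → v`, and deleting `uv` undoes this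
(`card_separatingForests_eq_card_trees`). For `(u, v) = (x, y)` this says that there are exactly
`M` separating forests.
Let `φ v` be the number of separating forests having `v` on the side of `x`, so that
`φ x - φ y = M`. By the correspondence, `φ u - φ v` is the net number of trees whose path from `x`
to `y` traverses `u → v`, and telescoping along these paths gives
`∑_{uv ∈ E} (f u - f v) (φ u - φ v) = N (f x - f y)` for all `f`
(`sum_mul_forestPotential_sub`). In particular `E(φ) = N M`, and the Cauchy–Schwarz inequality
yields the claim.

It remains to choose `f`. For the degree bound take `f = 1` at `x`, `-1` at `y` and `0` elsewhere.
For the girth bound let `f` be the distance from `x` in `G` without the edge `xy`, truncated at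
`g - 1`: it changes by at most one along every other edge, and `f y = g - 1` because a shorter
detour would close up to a cycle of length less than `g`.
-/

namespace SpanTree

open SimpleGraph Finset

variable {V : Type*}

/-! ### Trees whose path traverses a given edge -/

/-- In a tree `T`, this says that the path from `x` to `y` traverses the edge `uv` in the direction
from `u` to `v`. It is phrased through reachability in `T` without `uv`, so that it does not
mention the path. -/
def Traverses (T : SimpleGraph V) (x y u v : V) : Prop :=
  T.Adj u v ∧ (T.deleteEdges {s(u, v)}).Reachable x u ∧ (T.deleteEdges {s(u, v)}).Reachable v y

/-- A spanning forest of `G` with exactly two components, one containing `x` and the other `y`. -/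
structure IsSeparatingForest (G : SimpleGraph V) (x y : V) (F : SimpleGraph V) : Prop where
  le : F ≤ G
  isAcyclic : F.IsAcyclic
  not_reachable : ¬ F.Reachable x y
  reachable_or : ∀ w, F.Reachable x w ∨ F.Reachable y w

theorem reachable_deleteEdges_or_of_walk {T : SimpleGraph V} {u v : V} {a w : V} (p : T.Walk a w)
    (ha : (T.deleteEdges {s(u, v)}).Reachable u a ∨ (T.deleteEdges {s(u, v)}).Reachable v a) :
    (T.deleteEdges {s(u, v)}).Reachable u w ∨ (T.deleteEdges {s(u, v)}).Reachable v w := by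
  induction p with
  | nil => exact ha
  | @cons a b w h p ih =>
    refine ih ?_
    by_cases hab : s(a, b) = s(u, v)
    · rcases Sym2.eq_iff.mp hab with ⟨rfl, rfl⟩ | ⟨rfl, rfl⟩
      · exact Or.inr (Reachable.refl _)
      · exact Or.inl (Reachable.refl _)
    · have hadj : (T.deleteEdges {s(u, v)}).Adj a b := by
        rw [deleteEdges_adj]
        exact ⟨h, by simpa using hab⟩
      exact ha.imp (·.trans hadj.reachable) (·.trans hadj.reachable)

theorem IsSeparatingForest.not_adj {G F : SimpleGraph V} {x y u v : V}
    (hF : IsSeparatingForest G x y F) (hu : F.Reachable x u) (hv : F.Reachable v y) :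
    ¬ F.Adj u v :=
  fun h => hF.not_reachable ((hu.trans h.reachable).trans hv)

theorem sup_edge_deleteEdges {F : SimpleGraph V} {u v : V} (h : ¬ F.Adj u v) :
    (F ⊔ edge u v).deleteEdges {s(u, v)} = F := by
  ext a b
  simp only [deleteEdges_adj, sup_adj, edge_adj, Set.mem_singleton_iff, Sym2.eq_iff]
  constructor
  · rintro ⟨h1 | h1, h2⟩
    · exact h1
    · exact absurd (by tauto) h2
  · intro hab
    refine ⟨Or.inl hab, ?_⟩
    rintro (⟨rfl, rfl⟩ | ⟨rfl, rfl⟩)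
    · exact h hab
    · exact h hab.symm

theorem deleteEdges_sup_edge {T : SimpleGraph V} {u v : V} (h : T.Adj u v) :
    T.deleteEdges {s(u, v)} ⊔ edge u v = T := by
  ext a b
  simp only [deleteEdges_adj, sup_adj, edge_adj, Set.mem_singleton_iff, Sym2.eq_iff]
  constructor
  · rintro (h1 | ⟨⟨rfl, rfl⟩ | ⟨rfl, rfl⟩, h2⟩)
    · exact h1.1
    · exact h
    · exact h.symm
  · intro hab
    have := hab.ne
    tauto

theorem IsSeparatingForest.isTree_sup_edge {G F : SimpleGraph V} {x y u v : V}
    (hF : IsSeparatingForest G x y F) (hG : G.Adj u v) (hu : F.Reachable x u)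
    (hv : F.Reachable v y) : (F ⊔ edge u v).IsTree := by
  have hle : F ≤ F ⊔ edge u v := le_sup_left
  have huv : (F ⊔ edge u v).Adj u v := Or.inr (by simp [edge_adj, hG.ne])
  have hxy : (F ⊔ edge u v).Reachable x y :=
    ((hu.mono hle).trans huv.reachable).trans (hv.mono hle)
  have hx : ∀ w, (F ⊔ edge u v).Reachable x w := fun w =>
    (hF.reachable_or w).elim (·.mono hle) fun h => hxy.trans (h.mono hle)
  have : Nonempty V := ⟨x⟩
  exact ⟨⟨fun a b => (hx a).symm.trans (hx b)⟩,
    hF.isAcyclic.sup_edge_of_not_reachable fun h => hF.not_reachable ((hu.trans h).trans hv)⟩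

theorem IsSeparatingForest.traverses_sup_edge {G F : SimpleGraph V} {x y u v : V}
    (hF : IsSeparatingForest G x y F) (hG : G.Adj u v) (hu : F.Reachable x u)
    (hv : F.Reachable v y) : Traverses (F ⊔ edge u v) x y u v := by
  rw [Traverses, sup_edge_deleteEdges (hF.not_adj hu hv)]
  exact ⟨Or.inr (by simp [edge_adj, hG.ne]), hu, hv⟩

theorem Traverses.isSeparatingForest {G T : SimpleGraph V} {x y u v : V} (hle : T ≤ G)
    (hT : T.IsTree) (h : Traverses T x y u v) :
    IsSeparatingForest G x y (T.deleteEdges {s(u, v)}) where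
  le := (deleteEdges_le _).trans hle
  isAcyclic := hT.isAcyclic.anti (deleteEdges_le _)
  not_reachable hxy :=
    isAcyclic_iff_forall_adj_isBridge.mp hT.isAcyclic h.1
      ((h.2.1.symm.trans hxy).trans h.2.2.symm)
  reachable_or w := by
    obtain ⟨p⟩ := hT.connected u w
    exact (reachable_deleteEdges_or_of_walk p (Or.inl (Reachable.refl _))).imp
      h.2.1.trans h.2.2.symm.trans

open Classical in
/-- Adding and deleting the edge `uv` are mutually inverse between separating forests with `u` on
the side of `x` and `v` on the side of `y`, and spanning trees whose path from `x` to `y` traverses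
`u → v`. -/
theorem card_separatingForests_eq_card_trees [Fintype V] {G : SimpleGraph V} {x y u v : V}
    (hG : G.Adj u v) :
    #{F : SimpleGraph V | IsSeparatingForest G x y F ∧ F.Reachable x u ∧ F.Reachable v y} =
      #{T : SimpleGraph V | (T ≤ G ∧ T.IsTree) ∧ Traverses T x y u v} := by
  refine Finset.card_bij' (fun F _ => F ⊔ edge u v) (fun T _ => T.deleteEdges {s(u, v)})
    ?_ ?_ ?_ ?_
  · intro F hF
    simp only [mem_filter, mem_univ, true_and] at hF ⊢
    obtain ⟨hF, hu, hv⟩ := hF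
    refine ⟨⟨sup_le hF.le ?_, hF.isTree_sup_edge hG hu hv⟩, hF.traverses_sup_edge hG hu hv⟩
    rw [edge_le_iff]
    exact Or.inr hG
  · intro T hT
    simp only [mem_filter, mem_univ, true_and] at hT ⊢
    exact ⟨hT.2.isSeparatingForest hT.1.1 hT.1.2, hT.2.2⟩
  · intro F hF
    simp only [mem_filter, mem_univ, true_and] at hF
    exact sup_edge_deleteEdges (hF.1.not_adj hF.2.1 hF.2.2)
  · intro T hT
    simp only [mem_filter, mem_univ, true_and] at hT
    exact deleteEdges_sup_edge hT.2.1

theorem traverses_of_mem_darts {T : SimpleGraph V} {x y : V} {p : T.Walk x y} (hp : p.IsTrail)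
    {d : T.Dart} (hd : d ∈ p.darts) : Traverses T x y d.fst d.snd := by
  refine ⟨d.adj, ?_⟩
  induction p with
  | nil => simp at hd
  | @cons a b c h p ih =>
    rw [Walk.isTrail_cons] at hp
    rw [Walk.darts_cons, List.mem_cons] at hd
    rcases hd with rfl | hd
    · exact ⟨Reachable.refl _, ⟨p.toDeleteEdge _ hp.2⟩⟩
    · obtain ⟨h1, h2⟩ := ih hp.1 hd
      refine ⟨Reachable.trans (Adj.reachable ?_) h1, h2⟩
      rw [deleteEdges_adj, Set.mem_singleton_iff]
      refine ⟨h, fun he => hp.2 ?_⟩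
      rw [he]
      exact List.mem_map_of_mem hd

theorem Traverses.mem_darts {T : SimpleGraph V} (hT : T.IsAcyclic) {x y u v : V}
    (h : Traverses T x y u v) {p : T.Walk x y} (hp : p.IsTrail) :
    (⟨(u, v), h.1⟩ : T.Dart) ∈ p.darts := by
  have hbridge : ¬ (T.deleteEdges {s(u, v)}).Reachable u v :=
    isAcyclic_iff_forall_adj_isBridge.mp hT h.1
  by_cases he : s(u, v) ∈ p.edges
  · obtain ⟨d, hd, hde⟩ := List.mem_map.mp he
    rcases (dart_edge_eq_iff d ⟨(u, v), h.1⟩).mp hde with rfl | rfl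
    · exact hd
    · -- A path traversing `v → u` would join `x` to both `u` and `v` without the edge `uv`.
      have h1 := (traverses_of_mem_darts hp hd).2.1
      have hs : s(v, u) = s(u, v) := Sym2.eq_swap
      simp only [Dart.symm_mk, Prod.swap_prod_mk, hs] at h1
      exact absurd (h.2.1.symm.trans h1) hbridge
  · exact absurd ((h.2.1.symm.trans ⟨p.toDeleteEdge _ he⟩).trans h.2.2.symm) hbridge

theorem sum_darts_sub {T : SimpleGraph V} (f : V → ℝ) {x y : V} (p : T.Walk x y) :
    (p.darts.map fun d => f d.fst - f d.snd).sum = f x - f y := by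
  induction p with
  | nil => simp
  | cons h p ih => simp [ih]

open Classical in
/-- The differences of `f` telescope along the path from `x` to `y` in a tree. -/
theorem sum_traverses_sub [Fintype V] {T : SimpleGraph V} (hT : T.IsTree) (f : V → ℝ) (x y : V) :
    ∑ a : V × V, (if Traverses T x y a.1 a.2 then f a.1 - f a.2 else 0) = f x - f y := by
  obtain ⟨p, hp⟩ := (hT.existsUnique_path x y).exists
  have hset : ({a : V × V | Traverses T x y a.1 a.2} : Finset (V × V)) =
      (p.darts.map fun d => d.toProd).toFinset := by
    ext ⟨u, v⟩
    simp only [mem_filter, mem_univ, true_and, List.mem_toFinset, List.mem_map]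
    constructor
    · exact fun h => ⟨_, h.mem_darts hT.isAcyclic hp.isTrail, rfl⟩
    · rintro ⟨d, hd, hduv⟩
      have := traverses_of_mem_darts hp.isTrail hd
      simpa [hduv] using this
  have hnodup : (p.darts.map fun d => d.toProd).Nodup :=
    (Walk.darts_nodup_of_support_nodup hp.support_nodup).map Dart.toProd_injective
  rw [← Finset.sum_filter, hset, List.sum_toFinset _ hnodup, List.map_map]
  exact sum_darts_sub f p

/-! ### Dirichlet's principle -/

open Classical in
/-- The number of separating forests in which `v` lies on the side of `x`. -/
noncomputable def forestPotential [Fintype V] (G : SimpleGraph V) (x y v : V) : ℝ :=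
  #{F : SimpleGraph V | IsSeparatingForest G x y F ∧ F.Reachable x v}

open Classical in
theorem forestPotential_sub [Fintype V] {G : SimpleGraph V} {u v : V} (x y : V) (h : G.Adj u v) :
    forestPotential G x y u - forestPotential G x y v =
      #{T : SimpleGraph V | (T ≤ G ∧ T.IsTree) ∧ Traverses T x y u v} -
        #{T : SimpleGraph V | (T ≤ G ∧ T.IsTree) ∧ Traverses T x y v u} := by
  rw [← card_separatingForests_eq_card_trees h, ← card_separatingForests_eq_card_trees h.symm]
  simp only [forestPotential, card_filter, Nat.cast_sum, ← sum_sub_distrib]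
  refine sum_congr rfl fun F _ => ?_
  by_cases hF : IsSeparatingForest G x y F
  · have hside : ∀ w, F.Reachable w y ↔ ¬ F.Reachable x w := fun w =>
      ⟨fun hy hx => hF.not_reachable (hx.trans hy),
        fun hx => ((hF.reachable_or w).resolve_left hx).symm⟩
    by_cases hu : F.Reachable x u <;> by_cases hv : F.Reachable x v <;> simp [hF, hside, hu, hv]
  · simp [hF]

open Classical in
/-- The weak form of the equation `Δ φ = N (δ_x - δ_y)` for the forest potential `φ`, with `N` the
number of spanning trees. Every edge occurs in both orientations, whence the factor `2`. -/
theorem sum_mul_forestPotential_sub [Fintype V] (G : SimpleGraph V) (x y : V) (f : V → ℝ) :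
    ∑ a : V × V, (if G.Adj a.1 a.2 then (f a.1 - f a.2) *
        (forestPotential G x y a.1 - forestPotential G x y a.2) else 0) =
      2 * (#{T : SimpleGraph V | T ≤ G ∧ T.IsTree} * (f x - f y)) := by
  set c : V × V → ℝ := fun a =>
    #{T : SimpleGraph V | (T ≤ G ∧ T.IsTree) ∧ Traverses T x y a.1 a.2} with hc
  have hc0 : ∀ a : V × V, ¬ G.Adj a.1 a.2 → c a = 0 := by
    intro a ha
    simp only [hc, Nat.cast_eq_zero, card_eq_zero, filter_eq_empty_iff]
    exact fun T _ hT => ha (hT.1.1 hT.2.1)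
  have hsum : ∑ a : V × V, (f a.1 - f a.2) * c a =
      #{T : SimpleGraph V | T ≤ G ∧ T.IsTree} * (f x - f y) := by
    calc ∑ a : V × V, (f a.1 - f a.2) * c a
        = ∑ a : V × V, ∑ T : SimpleGraph V with T ≤ G ∧ T.IsTree,
            (if Traverses T x y a.1 a.2 then f a.1 - f a.2 else 0) := by
          refine sum_congr rfl fun a _ => ?_
          rw [← sum_filter, filter_filter, sum_const, nsmul_eq_mul, mul_comm]
      _ = ∑ T : SimpleGraph V with T ≤ G ∧ T.IsTree, (f x - f y) := by
          rw [sum_comm]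
          refine sum_congr rfl fun T hT => ?_
          exact sum_traverses_sub (mem_filter.mp hT).2.2 f x y
      _ = _ := by rw [sum_const, nsmul_eq_mul]
  have hswap : ∑ a : V × V, (f a.1 - f a.2) * c a.swap =
      - ∑ a : V × V, (f a.1 - f a.2) * c a := by
    rw [← sum_neg_distrib, ← (Equiv.prodComm V V).sum_comp]
    refine sum_congr rfl fun a _ => ?_
    simp only [Equiv.prodComm_apply, Prod.swap_swap, Prod.fst_swap, Prod.snd_swap]
    ring
  calc _ = ∑ a : V × V, ((f a.1 - f a.2) * c a - (f a.1 - f a.2) * c a.swap) := by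
        refine sum_congr rfl fun a _ => ?_
        split_ifs with h
        · rw [forestPotential_sub x y h, ← mul_sub]
          rfl
        · rw [hc0 a h, hc0 a.swap fun h' => h h'.symm]
          simp
    _ = _ := by
        rw [sum_sub_distrib, hswap, hsum]
        ring

/-- The Dirichlet energy of `f`, summed over ordered pairs: every edge is counted twice. -/
noncomputable def energy [Fintype V] (G : SimpleGraph V) [DecidableRel G.Adj] (f : V → ℝ) : ℝ :=
  ∑ a : V × V, if G.Adj a.1 a.2 then (f a.1 - f a.2) ^ 2 else 0

open Classical in
theorem forestPotential_sub_eq_card [Fintype V] {G : SimpleGraph V} {x y : V} (h : G.Adj x y) :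
    forestPotential G x y x - forestPotential G x y y =
      #{T : SimpleGraph V | (T ≤ G ∧ T.IsTree) ∧ T.Adj x y} := by
  rw [forestPotential_sub x y h]
  have h1 : ∀ T : SimpleGraph V, Traverses T x y x y ↔ T.Adj x y := fun T =>
    ⟨fun h => h.1, fun h => ⟨h, Reachable.refl _, Reachable.refl _⟩⟩
  have h2 : ∀ T : SimpleGraph V, (T ≤ G ∧ T.IsTree) → ¬ Traverses T x y y x := fun T hT h =>
    isAcyclic_iff_forall_adj_isBridge.mp hT.2.isAcyclic h.1 h.2.1.symm
  have h3 : #{T : SimpleGraph V | (T ≤ G ∧ T.IsTree) ∧ Traverses T x y y x} = 0 := by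
    rw [card_eq_zero, filter_eq_empty_iff]
    exact fun T _ hT => h2 T hT.1 hT.2
  simp only [h1, h3, Nat.cast_zero, sub_zero]

open Classical in
/-- Dirichlet's principle: the energy of any function bounds the fraction of spanning trees
containing the edge `xy` from below. -/
theorem sq_sub_mul_card_trees_le [Fintype V] {G : SimpleGraph V} (hG : G.Connected) {x y : V}
    (h : G.Adj x y) (f : V → ℝ) :
    2 * (f x - f y) ^ 2 * #{T : SimpleGraph V | T ≤ G ∧ T.IsTree} ≤
      energy G f * #{T : SimpleGraph V | (T ≤ G ∧ T.IsTree) ∧ T.Adj x y} := by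
  set φ := forestPotential G x y
  set N : ℝ := ((#{T : SimpleGraph V | T ≤ G ∧ T.IsTree} : ℕ) : ℝ) with hN
  set M : ℝ := ((#{T : SimpleGraph V | (T ≤ G ∧ T.IsTree) ∧ T.Adj x y} : ℕ) : ℝ)
  have hNpos : 0 < N := by
    rw [hN, Nat.cast_pos, card_pos]
    obtain ⟨T, hT⟩ := hG.exists_isTree_le
    exact ⟨T, by simpa using hT⟩
  have hφ : ∑ a : V × V with G.Adj a.1 a.2, (φ a.1 - φ a.2) ^ 2 = 2 * (N * M) := by
    have := sum_mul_forestPotential_sub G x y φ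
    rw [forestPotential_sub_eq_card h] at this
    rw [sum_filter, ← this]
    exact sum_congr rfl fun a _ => by rw [sq]
  have hf : ∑ a : V × V with G.Adj a.1 a.2, (f a.1 - f a.2) * (φ a.1 - φ a.2) =
      2 * (N * (f x - f y)) := by
    rw [sum_filter]
    exact sum_mul_forestPotential_sub G x y f
  have hCS := sum_mul_sq_le_sq_mul_sq ({a : V × V | G.Adj a.1 a.2} : Finset (V × V))
    (fun a => f a.1 - f a.2) (fun a => φ a.1 - φ a.2)
  rw [hφ, hf, sum_filter] at hCS
  change _ ≤ energy G f * _ at hCS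
  have h2N : 0 < 2 * N := by positivity
  refine le_of_mul_le_mul_left ?_ h2N
  linarith

open Classical in
theorem card_spanningTree [Fintype V] (G : SimpleGraph V) :
    Fintype.card (SpanningTree G) = #{T : SimpleGraph V | T ≤ G ∧ T.IsTree} := by
  rw [← Fintype.card_subtype]
  exact Fintype.card_congr (Equiv.refl _)

open Classical in
theorem card_spanningTree_adj [Fintype V] (G : SimpleGraph V) (x y : V) :
    #{T : SpanningTree G | T.1.Adj x y} =
      #{T : SimpleGraph V | (T ≤ G ∧ T.IsTree) ∧ T.Adj x y} := by
  refine Finset.card_bij (fun T _ => T.1) ?_ ?_ ?_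
  · intro T hT
    have := T.2
    simp_all
  · exact fun T _ T' _ h => Subtype.ext h
  · intro T hT
    simp only [mem_filter, mem_univ, true_and] at hT
    exact ⟨⟨T, hT.1⟩, mem_filter.mpr ⟨mem_univ _, hT.2⟩, rfl⟩

open Classical in
theorem edgeProb_uniform [Fintype V] {G : SimpleGraph V} (hG : G.Connected) (x y : V) :
    edgeProb (uniform G hG) s(x, y) =
      #{T : SimpleGraph V | (T ≤ G ∧ T.IsTree) ∧ T.Adj x y} /
        #{T : SimpleGraph V | T ≤ G ∧ T.IsTree} := by
  rw [← card_spanningTree, ← card_spanningTree_adj, edgeProb, card_filter, Nat.cast_sum,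
    div_eq_inv_mul, mul_sum]
  refine sum_congr rfl fun T _ => ?_
  simp [uniform]

theorem div_energy_le_edgeProb [Fintype V] {G : SimpleGraph V} [DecidableRel G.Adj]
    (hG : G.Connected) {x y : V} (h : G.Adj x y) (f : V → ℝ) {B : ℝ} (hB : 0 < B)
    (hf : energy G f ≤ B) : 2 * (f x - f y) ^ 2 / B ≤ edgeProb (uniform G hG) s(x, y) := by
  classical
  rw [edgeProb_uniform]
  have hle := sq_sub_mul_card_trees_le hG h f
  have hN : (0 : ℝ) < #{T : SimpleGraph V | T ≤ G ∧ T.IsTree} := by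
    rw [Nat.cast_pos, card_pos]
    obtain ⟨T, hT⟩ := hG.exists_isTree_le
    exact ⟨T, by simpa using hT⟩
  rw [div_le_div_iff₀ hB hN, mul_comm _ B]
  refine hle.trans (mul_le_mul_of_nonneg_right ?_ (Nat.cast_nonneg _))
  exact (le_of_eq (by unfold energy; congr!)).trans hf

/-! ### Test functions -/

theorem sum_adj_ite_fst [Fintype V] [DecidableEq V] (G : SimpleGraph V) [DecidableRel G.Adj]
    (x : V) : ∑ a : V × V, (if G.Adj a.1 a.2 then (if a.1 = x then (1 : ℝ) else 0) else 0) =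
      G.degree x := by
  rw [Fintype.sum_prod_type, Finset.sum_eq_single x]
  · simp [← card_neighborFinset_eq_degree, neighborFinset_eq_filter]
  · intro b _ hb
    simp [hb]
  · simp

theorem sum_adj_ite_snd [Fintype V] [DecidableEq V] (G : SimpleGraph V) [DecidableRel G.Adj]
    (x : V) : ∑ a : V × V, (if G.Adj a.1 a.2 then (if a.2 = x then (1 : ℝ) else 0) else 0) =
      G.degree x := by
  rw [← (Equiv.prodComm V V).sum_comp]
  refine (sum_congr rfl fun a _ => ?_).trans (sum_adj_ite_fst G x)
  exact if_congr (G.adj_comm a.2 a.1) rfl rfl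

theorem sum_adj_one [Fintype V] (G : SimpleGraph V) [DecidableRel G.Adj] :
    ∑ a : V × V, (if G.Adj a.1 a.2 then (1 : ℝ) else 0) = 2 * #G.edgeFinset := by
  have := G.sum_degrees_eq_twice_card_edges
  rw [Fintype.sum_prod_type]
  have h2 : (∑ v, (G.degree v : ℝ)) = 2 * #G.edgeFinset := by exact_mod_cast this
  rw [← h2]
  refine sum_congr rfl fun v _ => ?_
  simp [← card_neighborFinset_eq_degree, neighborFinset_eq_filter]

theorem sum_ite_eq_pair [Fintype V] [DecidableEq V] (x y : V) :
    ∑ a : V × V, (if a = (x, y) then (1 : ℝ) else 0) = 1 := by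
  simp

/-- The function here is `1` at `x`, `-1` at `y` and `0` elsewhere: the edge `xy` contributes `4`, and
every other edge at `x` or `y` at most `1`, an edge being incident to only one of the two. -/
theorem energy_dipole_le [Fintype V] [DecidableEq V] {G : SimpleGraph V} [DecidableRel G.Adj]
    {x y : V} (h : G.Adj x y) {d : ℕ} (hd : G.maxDegree ≤ d) :
    energy G (fun v => (if v = x then 1 else 0) - (if v = y then 1 else 0)) ≤
      4 * ((d : ℝ) + 1) := by
  have hne := h.ne
  -- Among ordered pairs, an adjacent pair counts `1` for each end at `x` or `y`, and the pairs
  -- `(x, y)` and `(y, x)`, counted `2` that way, need `2` more to reach `4`.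
  have hpt : ∀ a : V × V,
      (if G.Adj a.1 a.2 then ((((if a.1 = x then (1 : ℝ) else 0) - (if a.1 = y then 1 else 0)) -
        ((if a.2 = x then 1 else 0) - (if a.2 = y then 1 else 0))) ^ 2) else 0) ≤
      (((if G.Adj a.1 a.2 then (if a.1 = x then (1 : ℝ) else 0) else 0) +
        (if G.Adj a.1 a.2 then (if a.1 = y then (1 : ℝ) else 0) else 0)) +
      ((if G.Adj a.1 a.2 then (if a.2 = x then (1 : ℝ) else 0) else 0) +
        (if G.Adj a.1 a.2 then (if a.2 = y then (1 : ℝ) else 0) else 0))) +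
      2 * ((if a = (x, y) then (1 : ℝ) else 0) + (if a = (y, x) then (1 : ℝ) else 0)) := by
    rintro ⟨u, v⟩
    by_cases huv : G.Adj u v
    · have hne' := huv.ne
      simp only [huv, if_true, Prod.mk.injEq]
      by_cases h1 : u = x
      · subst h1
        by_cases h2 : v = y
        · subst h2
          simp [hne, hne.symm]; norm_num
        · simp [hne, hne'.symm, h2]
      · by_cases h1' : u = y
        · subst h1'
          by_cases h2 : v = x
          · subst h2
            simp [hne, hne.symm]; norm_num
          · simp [hne.symm, hne'.symm, h2]
        · by_cases h2 : v = x
          · subst h2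
            simp [hne, h1, h1']
          · by_cases h3 : v = y <;> simp [h1, h1', h2, h3, hne.symm]
    · simp only [huv, if_false]
      positivity
  have hx : (G.degree x : ℝ) ≤ d := by exact_mod_cast (G.degree_le_maxDegree x).trans hd
  have hy : (G.degree y : ℝ) ≤ d := by exact_mod_cast (G.degree_le_maxDegree y).trans hd
  refine (sum_le_sum fun a _ => hpt a).trans ?_
  rw [sum_add_distrib, sum_add_distrib, sum_add_distrib, sum_add_distrib, ← mul_sum,
    sum_add_distrib, sum_adj_ite_fst, sum_adj_ite_fst, sum_adj_ite_snd, sum_adj_ite_snd,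
    sum_ite_eq_pair, sum_ite_eq_pair]
  linarith

/-- The increment along `xy` itself is unrestricted; it contributes the first summand. -/
theorem energy_le_of_abs_sub_le_one [Fintype V] {G : SimpleGraph V} [DecidableRel G.Adj] {x y : V}
    (f : V → ℝ) (hf : ∀ u v, (G.deleteEdges {s(x, y)}).Adj u v → |f u - f v| ≤ 1) :
    energy G f ≤ 2 * ((f x - f y) ^ 2 + #G.edgeFinset) := by
  classical
  have hpt : ∀ a : V × V, (if G.Adj a.1 a.2 then (f a.1 - f a.2) ^ 2 else 0) ≤
      (if G.Adj a.1 a.2 then (1 : ℝ) else 0) +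
        (f x - f y) ^ 2 * ((if a = (x, y) then 1 else 0) + (if a = (y, x) then 1 else 0)) := by
    rintro ⟨u, v⟩
    by_cases huv : G.Adj u v
    · simp only [huv, if_true]
      have h0 : 0 ≤ (f x - f y) ^ 2 := sq_nonneg _
      by_cases he : s(u, v) = s(x, y)
      · rcases Sym2.eq_iff.mp he with ⟨rfl, rfl⟩ | ⟨rfl, rfl⟩
        · have : (0 : ℝ) ≤ if (u, v) = (v, u) then 1 else 0 := by positivity
          rw [if_pos rfl]
          nlinarith
        · have : (0 : ℝ) ≤ if (u, v) = (v, u) then 1 else 0 := by positivity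
          rw [if_pos rfl]
          nlinarith
      · have h1 := (sq_le_one_iff_abs_le_one _).mpr
          (hf u v (by rw [deleteEdges_adj]; exact ⟨huv, he⟩))
        refine h1.trans (le_add_of_nonneg_right (by positivity))
    · simp only [huv, if_false]
      positivity
  refine (sum_le_sum fun a _ => hpt a).trans ?_
  rw [sum_add_distrib, ← mul_sum, sum_add_distrib, sum_adj_one, sum_ite_eq_pair, sum_ite_eq_pair]
  linarith

theorem egirth_le_length_add_one_of_walk_deleteEdges {G : SimpleGraph V} {x y : V} (h : G.Adj x y)
    (p : (G.deleteEdges {s(x, y)}).Walk x y) : G.egirth ≤ (p.length + 1 : ℕ) := by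
  classical
  let q := p.toPath
  have hle : G.deleteEdges {s(x, y)} ≤ G := deleteEdges_le _
  have hcyc : (Walk.cons h.symm (q.1.mapLe hle)).IsCycle := by
    rw [Walk.cons_isCycle_iff]
    refine ⟨(Walk.isPath_mapLe hle).mpr q.2, fun he => ?_⟩
    rw [Walk.edges_mapLe_eq_edges] at he
    have := q.1.edges_subset_edgeSet he
    rw [mem_edgeSet, deleteEdges_adj] at this
    exact this.2 Sym2.eq_swap
  refine (egirth_le_length hcyc).trans ?_
  rw [Walk.length_cons, Nat.cast_le, Walk.length_mapLe]
  exact Nat.add_le_add_right p.length_bypass_le_length _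

open Classical in
/-- The distance from `x` in `H`, truncated at `k`; the value is `k` at vertices that `x` does not
reach, where `SimpleGraph.dist` is `0`. -/
noncomputable def truncatedDist (H : SimpleGraph V) (x : V) (k : ℕ) (v : V) : ℝ :=
  if H.Reachable x v then min (H.dist x v : ℝ) k else k

theorem truncatedDist_self (H : SimpleGraph V) (x : V) (k : ℕ) : truncatedDist H x k x = 0 := by
  simp [truncatedDist]

theorem truncatedDist_eq {H : SimpleGraph V} {x y : V} {k : ℕ}
    (h : ∀ p : H.Walk x y, k ≤ p.length) : truncatedDist H x k y = k := by
  rw [truncatedDist]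
  split_ifs with hr
  · obtain ⟨p, hp⟩ := hr.exists_walk_length_eq_dist
    rw [← hp]
    exact min_eq_right (by exact_mod_cast h p)
  · rfl

theorem abs_truncatedDist_sub_le {H : SimpleGraph V} (x : V) (k : ℕ) {u v : V} (h : H.Adj u v) :
    |truncatedDist H x k u - truncatedDist H x k v| ≤ 1 := by
  have hiff : H.Reachable x u ↔ H.Reachable x v :=
    ⟨(·.trans h.reachable), (·.trans h.reachable.symm)⟩
  by_cases hr : H.Reachable x v
  · rw [truncatedDist, truncatedDist, if_pos hr, if_pos (hiff.mpr hr)]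
    refine (abs_min_sub_min_le_max _ _ _ _).trans (max_le ?_ (by simp))
    have h1 := hr.dist_triangle_left u
    have h2 := (hiff.mpr hr).dist_triangle_left v
    rw [dist_eq_one_iff_adj.mpr h] at h2
    rw [dist_eq_one_iff_adj.mpr h.symm] at h1
    have h1' : (H.dist x u : ℝ) ≤ H.dist x v + 1 := by exact_mod_cast h1
    have h2' : (H.dist x v : ℝ) ≤ H.dist x u + 1 := by exact_mod_cast h2
    rw [abs_le]
    constructor <;> linarith
  · rw [truncatedDist, truncatedDist, if_neg hr, if_neg (mt hiff.mp hr)]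
    simp

end SpanTree

theorem lemma6 {V : Type*} [Fintype V] [DecidableEq V] (G : SimpleGraph V)
    [DecidableRel G.Adj] (hG : G.Connected) (hE : G.edgeFinset.Nonempty) :
    (∀ d : ℕ, G.maxDegree = d →
      2 / ((d : ℝ) + 1) ≤ SpanTree.kappa hE (SpanTree.uniform G hG)) ∧
    (∀ g : ℕ, 3 < g → (g : ℕ∞) ≤ G.egirth →
      1 / (1 + (G.edgeFinset.card : ℝ) / ((g : ℝ) - 1) ^ 2) ≤
        SpanTree.kappa hE (SpanTree.uniform G hG)) := by
  refine ⟨fun d hd => ?_, fun g hg hgirth => ?_⟩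
  · refine Finset.le_inf' _ _ fun e he => ?_
    induction e using Sym2.ind with | _ x y
    have h : G.Adj x y := by simpa using he
    refine le_trans (le_of_eq ?_) (SpanTree.div_energy_le_edgeProb hG h _ (by positivity)
      (SpanTree.energy_dipole_le h hd.le))
    simp only [if_true, if_neg h.ne, if_neg h.ne']
    field_simp
    norm_num
  · refine Finset.le_inf' _ _ fun e he => ?_
    induction e using Sym2.ind with | _ x y
    have h : G.Adj x y := by simpa using he
    obtain ⟨k, rfl⟩ : ∃ k, g = k + 1 := ⟨g - 1, by omega⟩
    have hk : (0 : ℝ) < k := by exact_mod_cast (by omega : 0 < k)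
    let H := G.deleteEdges {s(x, y)}
    have hy : SpanTree.truncatedDist H x k y = k := SpanTree.truncatedDist_eq fun p => by
      have := hgirth.trans (SpanTree.egirth_le_length_add_one_of_walk_deleteEdges h p)
      rw [Nat.cast_le] at this
      omega
    have henergy := SpanTree.energy_le_of_abs_sub_le_one (G := G) (x := x) (y := y)
      (SpanTree.truncatedDist H x k) fun u v huv => SpanTree.abs_truncatedDist_sub_le x k huv
    rw [SpanTree.truncatedDist_self, hy] at henergy
    refine le_trans (le_of_eq ?_)
      (SpanTree.div_energy_le_edgeProb hG h _ (by positivity) henergy)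
    rw [SpanTree.truncatedDist_self, hy]
    rw [Nat.cast_add_one, add_sub_cancel_right, zero_sub, neg_sq]
    field_simp
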